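/- Let $R$ be an associative ring with identity and let $\alpha : R \to R$ be a (unital) ring endomorphism. For a ring $S$, let $\mathrm{Nil}_*(S)$ denote the lower nilradical of $S$ (the intersection of all prime ideals of $S$), and let $$\Delta(S) = \{ s \in S : s + u \text{ is a unit of } S \text{ for every unit } u \text{ of } S \}.$$ Assume that $R$ is 2-primal, i.e. $\mathrm{Nil}_*(R)$ equals the set of all nilpotent elements of $R$, and that $R$ is $\alpha$-compatible, i.e. for all $a, b \in R$ one has $ab = 0$ if and only if $a\,\alpha(b) = 0$. Let $R[x;\alpha]$ be the skew polynomial ring, whose elements are the polynomials $\sum_i a_i x^i$ with coefficients written on the left and whose multiplication is determined by $xa = \alpha(a)x$ for $a \in R$. Then $$\Delta(R[x;\alpha]) = \Delta(R) + \mathrm{Nil}_*(R[x;\alpha])\,x = \{\, d + gx : d \in \Delta(R),\ g \in \mathrm{Nil}_*(R[x;\alpha]) \,\}.$$ -/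

import Mathlib

/-- `Δ(R)`: the elements `x` of `R` such that `x + u` is a unit for every unit `u`. -/
def Delta (R : Type*) [Ring R] : Set R :=
  {x | ∀ u : R, IsUnit u → IsUnit (x + u)}

/-- A prime ideal of a not necessarily commutative ring: a proper two-sided ideal `P` such that
`I J ⊆ P` implies `I ⊆ P` or `J ⊆ P`, for all two-sided ideals `I`, `J`. -/
def TwoSidedIdeal.IsPrimeIdeal {R : Type*} [Ring R] (P : TwoSidedIdeal R) : Prop :=
  P ≠ ⊤ ∧ ∀ I J : TwoSidedIdeal R, (∀ a ∈ I, ∀ b ∈ J, a * b ∈ P) → I ≤ P ∨ J ≤ P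

/-- The lower nilradical (prime radical) `Nil_*(R)`: the intersection of all prime ideals. -/
def lowerNilradical (R : Type*) [Ring R] : TwoSidedIdeal R :=
  sInf {P | P.IsPrimeIdeal}

/-- `R` is 2-primal if `Nil_*(R)` is exactly the set of nilpotent elements of `R`. -/
def IsTwoPrimal (R : Type*) [Ring R] : Prop :=
  ∀ a : R, a ∈ lowerNilradical R ↔ IsNilpotent a

/-- `R` is `α`-compatible if `a b = 0` is equivalent to `a α(b) = 0`, for all `a`, `b`. -/
def IsCompatible {R : Type*} [Ring R] (α : R →+* R) : Prop :=
  ∀ a b : R, a * b = 0 ↔ a * α b = 0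

/-- The action of `ℕ` (written multiplicatively) on `R` through the powers of the ring endomorphism
`α`. With it, the ring `SkewPolynomial R` is `R[x;α]`, in which `x a = α(a) x`. -/
abbrev powersAction {R : Type*} [Ring R] (α : R →+* R) :
    MulSemiringAction (Multiplicative ℕ) R :=
  MulSemiringAction.compHom R (powersHom (R →+* R) α)

theorem powersAction_X_mul_C {R : Type*} [Ring R] (α : R →+* R) (a : R) :
    letI := powersAction α
    (SkewPolynomial.X * SkewPolynomial.C a : SkewPolynomial R) =
      SkewPolynomial.C (α a) * SkewPolynomial.X := by
  let := powersAction α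
  have h : (SkewPolynomial.φ : R →+* R) a = α a := by
    change (powersHom (R →+* R) α (Multiplicative.ofAdd 1)) a = α a
    simp
  rw [← SkewPolynomial.monomial_zero_left, ← SkewPolynomial.monomial_zero_left,
    SkewPolynomial.X_mul_monomial, SkewPolynomial.monomial_mul_X, h]

/-! The point is that a unit of `R[x;α]` has a unit constant term and all higher coefficients in
`Nil_*(R)`. If `f ∈ Δ`, then `f + 1` is a unit, so `f` has such higher coefficients; by
`C_mem_lowerNilradical` its tail is `g x` with `g` in the lower nilradical. Taking constant terms is
multiplicative, which puts that of `f` in `Δ(R)`. Conversely, `C d + g x` plus a unit is a unit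
constant plus an element of the nil ideal `Nil_*(R[x;α])`, hence a unit. -/

open SkewPolynomial

/-! ### Prime ideals, m-systems and the lower nilradical -/

section PrimeRadical

variable {R : Type*} [Ring R]

theorem mem_lowerNilradical {a : R} :
    a ∈ lowerNilradical R ↔ ∀ P : TwoSidedIdeal R, P.IsPrimeIdeal → a ∈ P :=
  TwoSidedIdeal.mem_sInf R

/-- The union of a nonempty chain of two-sided ideals. -/
def TwoSidedIdeal.chainUnion (c : Set (TwoSidedIdeal R)) (hc : IsChain (· ≤ ·) c)
    (hne : c.Nonempty) : TwoSidedIdeal R :=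
  .mk' {x | ∃ I ∈ c, x ∈ I}
    (hne.imp fun I hI => ⟨hI, I.zero_mem⟩)
    (by
      rintro x y ⟨I, hI, hx⟩ ⟨J, hJ, hy⟩
      rcases hc.total hI hJ with h | h
      · exact ⟨J, hJ, J.add_mem (h hx) hy⟩
      · exact ⟨I, hI, I.add_mem hx (h hy)⟩)
    (by rintro x ⟨I, hI, hx⟩; exact ⟨I, hI, I.neg_mem hx⟩)
    (by rintro x y ⟨I, hI, hy⟩; exact ⟨I, hI, I.mul_mem_left _ _ hy⟩)
    (by rintro x y ⟨I, hI, hx⟩; exact ⟨I, hI, I.mul_mem_right _ _ hx⟩)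

theorem TwoSidedIdeal.mem_chainUnion {c : Set (TwoSidedIdeal R)} {hc : IsChain (· ≤ ·) c}
    {hne : c.Nonempty} {x : R} : x ∈ chainUnion c hc hne ↔ ∃ I ∈ c, x ∈ I := by
  simp [chainUnion]

/-- Some prime ideal avoids any given m-system. -/
theorem exists_isPrimeIdeal_of_mSystem (M : Set R) (h0 : (0 : R) ∉ M) (hne : M.Nonempty)
    (hM : ∀ b ∈ M, ∀ c ∈ M, ∃ r, b * r * c ∈ M) :
    ∃ P : TwoSidedIdeal R, P.IsPrimeIdeal ∧ ∀ b ∈ M, b ∉ P := by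
  obtain ⟨P, -, hP⟩ := zorn_le_nonempty₀ {I : TwoSidedIdeal R | ∀ b ∈ M, b ∉ I}
    (fun c hcS hc I hI => ⟨TwoSidedIdeal.chainUnion c hc ⟨I, hI⟩, by
      intro b hb hbc
      obtain ⟨J, hJ, hbJ⟩ := TwoSidedIdeal.mem_chainUnion.1 hbc
      exact hcS hJ b hb hbJ,
      fun J hJ x hx => TwoSidedIdeal.mem_chainUnion.2 ⟨J, hJ, hx⟩⟩)
    ⊥ (by
      intro b hb hb0
      rw [TwoSidedIdeal.mem_bot] at hb0
      exact h0 (hb0 ▸ hb))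
  refine ⟨P, ⟨?_, ?_⟩, hP.prop⟩
  · rintro rfl
    obtain ⟨b, hb⟩ := hne
    exact hP.prop b hb (TwoSidedIdeal.mem_top R)
  -- By maximality of `P`, the larger ideal `P + I` meets `M`.
  · have key : ∀ I : TwoSidedIdeal R, ¬ I ≤ P → ∃ b ∈ M, ∃ x ∈ P, ∃ y ∈ I, x + y = b := by
      intro I hI
      by_contra hcon
      push Not at hcon
      refine hI (le_trans le_sup_right (hP.le_of_ge (y := P ⊔ I) ?_ le_sup_left))
      intro b hb hbI
      obtain ⟨x, hx, y, hy, hxy⟩ := TwoSidedIdeal.mem_sup.1 hbI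
      exact hcon b hb x hx y hy hxy
    intro I J hIJ
    by_contra! hcon
    obtain ⟨b, hb, x, hx, y, hy, rfl⟩ := key I hcon.1
    obtain ⟨c, hc, z, hz, w, hw, rfl⟩ := key J hcon.2
    obtain ⟨r, hr⟩ := hM _ hb _ hc
    refine hP.prop _ hr ?_
    have : (x + y) * r * (z + w) = x * (r * (z + w)) + y * r * z + y * r * w := by noncomm_ring
    rw [this]
    exact P.add_mem (P.add_mem (P.mul_mem_right _ _ hx) (P.mul_mem_left _ _ hz))
      (hIJ _ (I.mul_mem_right _ _ hy) _ hw)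

theorem notMem_lowerNilradical_of_mSystem (M : Set R) (h0 : (0 : R) ∉ M)
    (hM : ∀ b ∈ M, ∀ c ∈ M, ∃ r, b * r * c ∈ M) {a : R} (ha : a ∈ M) :
    a ∉ lowerNilradical R := by
  obtain ⟨P, hP, hPM⟩ := exists_isPrimeIdeal_of_mSystem M h0 ⟨a, ha⟩ hM
  exact fun h => hPM a ha (mem_lowerNilradical.1 h P hP)

theorem isNilpotent_of_mem_lowerNilradical {a : R} (ha : a ∈ lowerNilradical R) :
    IsNilpotent a := by
  by_contra hn
  refine notMem_lowerNilradical_of_mSystem (Set.range fun n : ℕ => a ^ n) ?_ ?_ ⟨1, pow_one a⟩ ha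
  · rintro ⟨n, h⟩
    exact hn ⟨n, h⟩
  · rintro _ ⟨m, rfl⟩ _ ⟨n, rfl⟩
    exact ⟨1, m + n, by simp [pow_add]⟩

/-- Otherwise the ideals `J = {y | f R y ⊆ P}` and `I = {x | x R J ⊆ P}` contain `f'` and `f`
respectively, while `I J ⊆ P`. -/
theorem TwoSidedIdeal.IsPrimeIdeal.exists_mul_notMem {P : TwoSidedIdeal R} (hP : P.IsPrimeIdeal)
    {f f' : R} (hf : f ∉ P) (hf' : f' ∉ P) : ∃ g, f * g * f' ∉ P := by
  by_contra! hcon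
  let J : TwoSidedIdeal R := .mk' {y | ∀ g, f * g * y ∈ P}
    (fun g => by simp [P.zero_mem])
    (fun {x y} hx hy g => by rw [mul_add]; exact P.add_mem (hx g) (hy g))
    (fun {x} hx g => by rw [mul_neg]; exact P.neg_mem (hx g))
    (fun {x y} hy g => by simpa only [mul_assoc] using hy (g * x))
    (fun {x y} hx g => by rw [← mul_assoc]; exact P.mul_mem_right _ _ (hx g))
  let I : TwoSidedIdeal R := .mk' {x | ∀ g, ∀ y ∈ J, x * g * y ∈ P}
    (fun g y _ => by simp [P.zero_mem])
    (fun {x y} hx hy g z hz => by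
      rw [add_mul, add_mul]; exact P.add_mem (hx g z hz) (hy g z hz))
    (fun {x} hx g z hz => by rw [neg_mul, neg_mul]; exact P.neg_mem (hx g z hz))
    (fun {x y} hy g z hz => by
      simpa only [mul_assoc] using P.mul_mem_left x _ (hy g z hz))
    (fun {x y} hx g z hz => by simpa only [mul_assoc] using hx (y * g) z hz)
  have hJ : ∀ {y}, y ∈ J ↔ ∀ g, f * g * y ∈ P := TwoSidedIdeal.mem_mk' ..
  have hI : ∀ {x}, x ∈ I ↔ ∀ g, ∀ y ∈ J, x * g * y ∈ P := TwoSidedIdeal.mem_mk' ..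
  rcases hP.2 I J (fun a ha b hb => by simpa using hI.1 ha 1 b hb) with h | h
  · exact hf (h (hI.2 fun g y hy => hJ.1 hy g))
  · exact hf' (h (hJ.2 hcon))

theorem IsUnit.add_of_mem_lowerNilradical {u n : R} (hu : IsUnit u)
    (hn : n ∈ lowerNilradical R) : IsUnit (u + n) := by
  obtain ⟨u, rfl⟩ := hu
  have h : (u : R) + n = u * (1 + ↑u⁻¹ * n) := by simp [mul_add]
  rw [h]
  exact u.isUnit.mul (isNilpotent_of_mem_lowerNilradical
    ((lowerNilradical R).mul_mem_left _ _ hn)).isUnit_one_add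

end PrimeRadical

/-! ### 2-primal rings: calculus modulo the nilradical, where the quotient is reduced -/

section TwoPrimal

variable {R : Type*} [Ring R]

theorem isNilpotent_mul_swap {a b : R} (h : IsNilpotent (a * b)) : IsNilpotent (b * a) := by
  obtain ⟨n, hn⟩ := h
  have key : ∀ n : ℕ, (b * a) ^ (n + 1) = b * (a * b) ^ n * a := by
    intro n
    induction n with
    | zero => simp
    | succ n ih => rw [pow_succ, ih, pow_succ (a * b)]; simp only [mul_assoc]
  exact ⟨n + 1, by rw [key, hn]; simp⟩

namespace IsTwoPrimal

variable (hR : IsTwoPrimal R)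
include hR

theorem mem_swap {a b : R} (h : a * b ∈ lowerNilradical R) : b * a ∈ lowerNilradical R :=
  (hR _).2 (isNilpotent_mul_swap ((hR _).1 h))

theorem mem_of_sq_mem {a : R} (h : a * a ∈ lowerNilradical R) : a ∈ lowerNilradical R := by
  obtain ⟨n, hn⟩ := (hR _).1 h
  exact (hR _).2 ⟨2 * n, by rw [pow_mul, pow_two, hn]⟩

theorem mem_insert {a b : R} (h : a * b ∈ lowerNilradical R) (r : R) :
    a * r * b ∈ lowerNilradical R := by
  refine hR.mem_of_sq_mem ?_
  have : a * r * b * (a * r * b) = a * r * (b * a) * (r * b) := by simp only [mul_assoc]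
  rw [this]
  exact TwoSidedIdeal.mul_mem_right _ _ _ (TwoSidedIdeal.mul_mem_left _ _ _ (hR.mem_swap h))

theorem mem_of_sq_mul_mem {a b : R} (h : a * (a * b) ∈ lowerNilradical R) :
    a * b ∈ lowerNilradical R :=
  hR.mem_of_sq_mem (by simpa only [mul_assoc] using hR.mem_insert h b)

end IsTwoPrimal

end TwoPrimal

/-! ### Compatibility: applying `α` to a factor does not affect vanishing -/

section Compatible

variable {R : Type*} [Ring R]

/-- `u` and `v` may be exchanged inside any product without changing whether it vanishes. -/
def Interchangeable (u v : R) : Prop :=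
  ∀ p q : R, p * u * q = 0 ↔ p * v * q = 0

namespace Interchangeable

theorem refl (u : R) : Interchangeable u u := fun _ _ => Iff.rfl

theorem trans {u v w : R} (h : Interchangeable u v) (h' : Interchangeable v w) :
    Interchangeable u w := fun p q => (h p q).trans (h' p q)

theorem mul {u v u' v' : R} (h : Interchangeable u v) (h' : Interchangeable u' v') :
    Interchangeable (u * u') (v * v') := by
  intro p q
  have h1 := h p (u' * q)
  have h2 := h' (p * v) q
  simp only [mul_assoc] at h1 h2 ⊢
  exact h1.trans h2

theorem pow {u v : R} (h : Interchangeable u v) (n : ℕ) : Interchangeable (u ^ n) (v ^ n) := by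
  induction n with
  | zero => simpa using refl 1
  | succ n ih => simpa only [pow_succ] using ih.mul h

theorem eq_zero_iff {u v : R} (h : Interchangeable u v) : u = 0 ↔ v = 0 := by
  simpa using h 1 1

theorem isNilpotent_iff {u v : R} (h : Interchangeable u v) : IsNilpotent u ↔ IsNilpotent v :=
  exists_congr fun n => (h.pow n).eq_zero_iff

theorem mem_lowerNilradical_iff (hR : IsTwoPrimal R) {u v : R} (h : Interchangeable u v) :
    u ∈ lowerNilradical R ↔ v ∈ lowerNilradical R := by
  rw [hR, hR, h.isNilpotent_iff]

end Interchangeable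

theorem IsCompatible.interchangeable_iterate {α : R →+* R} (hα : IsCompatible α) (n : ℕ) (u : R) :
    Interchangeable u (α^[n] u) := by
  induction n with
  | zero => exact .refl u
  | succ n ih =>
    rw [Function.iterate_succ_apply']
    refine ih.trans fun p q => ?_
    -- Apply `α` to the whole right factor `u q`, then remove it from `q` alone.
    rw [mul_assoc, hα, map_mul, ← mul_assoc, ← hα]

end Compatible

/-! ### Coefficients, units and `Δ` of the skew polynomial ring -/

namespace SkewPolynomial

variable {R : Type*} [Ring R]

theorem coeff_add' (f g : SkewPolynomial R) (n : ℕ) :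
    (f + g).coeff n = f.coeff n + g.coeff n := by
  simp [SkewPolynomial.coeff]

theorem eq_sum_monomial (f : SkewPolynomial R) : f = ∑ n ∈ f.support, monomial n (f.coeff n) := by
  rw [← sum_def, sum_monomial]

theorem exists_coeff_eq_zero (f : SkewPolynomial R) : ∃ N, ∀ n, N ≤ n → f.coeff n = 0 := by
  refine ⟨f.support.sup id + 1, fun n hn => ?_⟩
  by_contra h
  have : n ≤ f.support.sup id := Finset.le_sup (f := id) (mem_support_iff.2 h)
  omega

variable [MulSemiringAction (Multiplicative ℕ) R]

theorem coeff_mul' (f g : SkewPolynomial R) (n : ℕ) :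
    (f * g).coeff n =
      ∑ p ∈ Finset.HasAntidiagonal.antidiagonal n, f.coeff p.1 * (φ : R →+* R)^[p.1] (g.coeff p.2) := by
  have h := SkewMonoidAlgebra.coeff_mul_antidiagonal_of_finset f g (Multiplicative.ofAdd n)
    ((Finset.HasAntidiagonal.antidiagonal n).map
      ((Multiplicative.ofAdd.toEmbedding).prodMap Multiplicative.ofAdd.toEmbedding)) (by
      rintro ⟨a, b⟩
      induction a using Multiplicative.rec
      induction b using Multiplicative.rec
      simp [← ofAdd_add])
  rw [SkewPolynomial.coeff, h, Finset.sum_map]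
  simp [φ_iterate_apply, SkewPolynomial.coeff]

theorem coeff_mul_zero (f g : SkewPolynomial R) :
    (f * g).coeff 0 = f.coeff 0 * g.coeff 0 := by
  simp [coeff_mul']

theorem isUnit_coeff_zero {f : SkewPolynomial R} (hf : IsUnit f) : IsUnit (f.coeff 0) := by
  obtain ⟨g, h1, h2⟩ := isUnit_iff_exists.1 hf
  exact isUnit_iff_exists.2 ⟨g.coeff 0, by rw [← coeff_mul_zero, h1, coeff_one_zero],
    by rw [← coeff_mul_zero, h2, coeff_one_zero]⟩

theorem sum_mem_twoSidedIdeal {S ι : Type*} [Ring S] (I : TwoSidedIdeal S) (s : Finset ι)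
    (f : ι → S) (h : ∀ i ∈ s, f i ∈ I) : ∑ i ∈ s, f i ∈ I :=
  Finset.sum_induction f (· ∈ I) (fun _ _ => I.add_mem) I.zero_mem h

theorem monomial_mem (I : TwoSidedIdeal (SkewPolynomial R)) {a : R} (h : C a ∈ I) (n : ℕ) :
    monomial n a ∈ I := by
  rw [← C_mul_X_pow_eq_monomial]
  exact I.mul_mem_right _ _ h

theorem mem_of_coeff_mem (I : TwoSidedIdeal (SkewPolynomial R)) {f : SkewPolynomial R}
    (h : ∀ n, C (f.coeff n) ∈ I) : f ∈ I := by
  rw [eq_sum_monomial f]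
  exact sum_mem_twoSidedIdeal _ _ _ fun n _ => monomial_mem I (h n) n

theorem eq_C_add_mul_X (f : SkewPolynomial R) :
    ∃ g : SkewPolynomial R, f = C (f.coeff 0) + g * X ∧ ∀ n, g.coeff n = f.coeff (n + 1) := by
  classical
  induction f using SkewMonoidAlgebra.induction_on' with
  | single a r =>
    induction a using Multiplicative.rec with | ofAdd a => ?_
    change ∃ g : SkewPolynomial R, monomial a r = C ((monomial a r).coeff 0) + g * X ∧
      ∀ n, g.coeff n = (monomial a r).coeff (n + 1)
    cases a with
    | zero => exact ⟨0, by simp, by simp⟩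
    | succ a => exact ⟨monomial a r, by simp, by simp [coeff_monomial]⟩
  | add f g hf hg =>
    obtain ⟨f', hf, hf'⟩ := hf
    obtain ⟨g', hg, hg'⟩ := hg
    refine ⟨f' + g', ?_, fun n => by simp only [coeff_add', hf', hg']⟩
    rw [coeff_add', C_add, add_mul]
    nth_rw 1 [hf, hg]
    abel

section TwoPrimalCompatible

variable (hR : IsTwoPrimal R) (hα : IsCompatible (φ : R →+* R))
include hα

/-- A prime `P` missing `C a` yields an m-system of `R` containing `a`. Interchangeability absorbs
the powers of `α` that multiplying monomials creates. -/
theorem C_mem_lowerNilradical {a : R} (ha : a ∈ lowerNilradical R) :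
    C a ∈ lowerNilradical (SkewPolynomial R) := by
  refine mem_lowerNilradical.2 fun P hP => ?_
  by_contra hC
  refine notMem_lowerNilradical_of_mSystem
    {b : R | ∃ (c : R) (k : ℕ), monomial k c ∉ P ∧ Interchangeable b c} ?_ ?_
    ⟨a, 0, hC, .refl a⟩ ha
  · rintro ⟨c, k, hc, h⟩
    rw [h.eq_zero_iff.1 rfl, monomial_zero_right] at hc
    exact hc P.zero_mem
  · rintro b ⟨c, k, hc, hbc⟩ b' ⟨c', k', hc', hbc'⟩
    obtain ⟨g, hg⟩ := hP.exists_mul_notMem hc hc'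
    obtain ⟨i, r, hir⟩ : ∃ i r, monomial k c * monomial i r * monomial k' c' ∉ P := by
      by_contra! hcon
      refine hg ?_
      rw [eq_sum_monomial g, Finset.mul_sum, Finset.sum_mul]
      exact sum_mem_twoSidedIdeal _ _ _ fun n _ => hcon n _
    rw [monomial_mul_monomial, monomial_mul_monomial] at hir
    exact ⟨r, _, _, hir, (hbc.mul (hα.interchangeable_iterate _ _)).mul
      (hbc'.trans (hα.interchangeable_iterate _ _))⟩

theorem exists_eq_C_add_mul_X {f : SkewPolynomial R}
    (hf : ∀ n, 1 ≤ n → f.coeff n ∈ lowerNilradical R) :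
    ∃ g ∈ lowerNilradical (SkewPolynomial R), f = C (f.coeff 0) + g * X := by
  obtain ⟨g, hfg, hg⟩ := eq_C_add_mul_X f
  refine ⟨g, mem_of_coeff_mem _ fun n => ?_, hfg⟩
  rw [hg]
  exact C_mem_lowerNilradical hα (hf _ (by omega))

include hR

/-- Descending induction on `j`: multiply the vanishing coefficient of `x^(n+j)` in `u v` by `u_n`
on the left. Terms with `i < n` involve `v_l` with `l > j` and are covered by induction; those with
`i > n` by `hu`. What remains is `u_n u_n α^n(v_j)`. -/
theorem coeff_mul_mem_of_mul_eq_one {u v : SkewPolynomial R} (huv : u * v = 1) {n : ℕ}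
    (hn : 1 ≤ n) (hu : ∀ m, n < m → u.coeff m ∈ lowerNilradical R) (j : ℕ) :
    u.coeff n * v.coeff j ∈ lowerNilradical R := by
  obtain ⟨N, hN⟩ := v.exists_coeff_eq_zero
  suffices H : ∀ d j, N ≤ j + d → u.coeff n * v.coeff j ∈ lowerNilradical R from
    H N j (by omega)
  intro d
  induction d with
  | zero =>
    intro j hj
    rw [hN j hj, mul_zero]
    exact TwoSidedIdeal.zero_mem _
  | succ d ih =>
    intro j hj
    have hsum := coeff_mul' u v (n + j)
    rw [huv, coeff_one, if_neg (by omega),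
      ← Finset.add_sum_erase _ _ (Finset.HasAntidiagonal.mem_antidiagonal.2 (rfl : (n, j).1 + (n, j).2 = n + j))]
      at hsum
    have hrest : u.coeff n * ∑ p ∈ (Finset.HasAntidiagonal.antidiagonal (n + j)).erase (n, j),
        u.coeff p.1 * (φ : R →+* R)^[p.1] (v.coeff p.2) ∈ lowerNilradical R := by
      rw [Finset.mul_sum]
      refine sum_mem_twoSidedIdeal _ _ _ ?_
      rintro ⟨i, l⟩ hil
      simp only [Finset.mem_erase, ne_eq, Prod.mk.injEq, Finset.HasAntidiagonal.mem_antidiagonal] at hil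
      rcases lt_trichotomy i n with h | h | h
      · rw [← mul_assoc]
        refine hR.mem_insert ?_ _
        exact (((Interchangeable.refl _).mul
          (hα.interchangeable_iterate i _)).mem_lowerNilradical_iff hR).1 (ih l (by omega))
      · omega
      · exact TwoSidedIdeal.mul_mem_left _ _ _ (TwoSidedIdeal.mul_mem_right _ _ _ (hu i h))
    have hmain : u.coeff n * (u.coeff n * (φ : R →+* R)^[n] (v.coeff j)) ∈
        lowerNilradical R := by
      rw [eq_neg_of_add_eq_zero_left hsum.symm, mul_neg]
      exact TwoSidedIdeal.neg_mem _ hrest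
    exact (((Interchangeable.refl _).mul
      (hα.interchangeable_iterate n _)).mem_lowerNilradical_iff hR).2 (hR.mem_of_sq_mul_mem hmain)

theorem coeff_mem_lowerNilradical_of_isUnit {u : SkewPolynomial R} (hu : IsUnit u) {n : ℕ}
    (hn : 1 ≤ n) : u.coeff n ∈ lowerNilradical R := by
  obtain ⟨v, huv, hvu⟩ := isUnit_iff_exists.1 hu
  obtain ⟨w, hw⟩ := isUnit_coeff_zero (isUnit_iff_exists.2 ⟨u, hvu, huv⟩)
  obtain ⟨N, hN⟩ := u.exists_coeff_eq_zero
  suffices H : ∀ d n, 1 ≤ n → N ≤ n + d → u.coeff n ∈ lowerNilradical R from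
    H N n hn (by omega)
  intro d
  induction d with
  | zero =>
    intro n _ h
    rw [hN n h]
    exact TwoSidedIdeal.zero_mem _
  | succ d ih =>
    intro n hn h
    -- Descending induction on `n`; at `j = 0` the factor `v_0` is a unit and cancels.
    have := coeff_mul_mem_of_mul_eq_one hR hα huv hn
      (fun m hm => ih m (by omega) (by omega)) 0
    rw [← hw] at this
    simpa using TwoSidedIdeal.mul_mem_right _ _ (↑w⁻¹ : R) this

theorem Delta_eq :
    Delta (SkewPolynomial R) =
      {f | ∃ d ∈ Delta R, ∃ g ∈ lowerNilradical (SkewPolynomial R), f = C d + g * X} := by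
  have hC : ∀ {a : R}, IsUnit a → IsUnit (C a : SkewPolynomial R) := fun h =>
    h.map (CRingHom : R →+* SkewPolynomial R)
  ext f
  constructor
  · intro hf
    obtain ⟨g, hg, hfg⟩ := exists_eq_C_add_mul_X (f := f) hα (fun n hn => by
      have := coeff_mem_lowerNilradical_of_isUnit hR hα (hf 1 isUnit_one) hn
      rwa [coeff_add', coeff_one, if_neg (by omega), add_zero] at this)
    refine ⟨f.coeff 0, fun u hu => ?_, g, hg, hfg⟩
    simpa [coeff_add'] using isUnit_coeff_zero (hf (C u) (hC hu))
  · rintro ⟨d, hd, g, hg, rfl⟩ u hu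
    obtain ⟨h, hh, huh⟩ := exists_eq_C_add_mul_X (f := u) hα
      (fun n hn => coeff_mem_lowerNilradical_of_isUnit hR hα hu hn)
    have : C d + g * X + u = C (d + u.coeff 0) + (g + h) * X := by
      nth_rw 1 [huh]
      rw [C_add, add_mul]
      abel
    rw [this]
    exact (hC (hd _ (isUnit_coeff_zero hu))).add_of_mem_lowerNilradical
      (TwoSidedIdeal.mul_mem_right _ _ _ (TwoSidedIdeal.add_mem _ hg hh))

end TwoPrimalCompatible

end SkewPolynomial

theorem phi_powersAction {R : Type*} [Ring R] (α : R →+* R) :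
    letI := powersAction α
    (SkewPolynomial.φ : R →+* R) = α := by
  ext a
  change (powersHom (R →+* R) α (Multiplicative.ofAdd 1)) a = α a
  simp

theorem proposition2p4 {R : Type*} [Ring R] (α : R →+* R)
    (hR : IsTwoPrimal R) (hα : IsCompatible α) :
    letI : MulSemiringAction (Multiplicative ℕ) R := powersAction α
    Delta (SkewPolynomial R) =
      {f | ∃ d ∈ Delta R, ∃ g ∈ lowerNilradical (SkewPolynomial R),
        f = SkewPolynomial.C d + g * SkewPolynomial.X} := by
  let : MulSemiringAction (Multiplicative ℕ) R := powersAction α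
  refine SkewPolynomial.Delta_eq hR ?_
  rw [phi_powersAction]
  exact hα
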